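/- A directed graph $\Gamma$ consists of a vertex set $V\Gamma$ and a set $E\Gamma$ of ordered pairs of distinct vertices. It is connected if any two vertices are joined by a path in which the directions of the edges are ignored. It has connectivity one if it is connected and there is a vertex $\alpha$ such that the induced graph $\Gamma\setminus\{\alpha\}$ is not connected. A block of $\Gamma$ is a connected subgraph that is maximal subject to the condition that it does not have connectivity one. An automorphism of $\Gamma$ is a permutation $\sigma$ of $V\Gamma$ with $e\in E\Gamma\Leftrightarrow e^\sigma\in E\Gamma$. The graph $\Gamma$ is vertex-transitive if $\operatorname{Aut}\Gamma$ is transitive on $V\Gamma$; it is primitive if $\operatorname{Aut}\Gamma$ is transitive on $V\Gamma$ and the only $\operatorname{Aut}\Gamma$-invariant equivalence relations on $V\Gamma$ are the trivial and the universal one; and it is automorphism-regular if $\operatorname{Aut}\Gamma$ is transitive on $V\Gamma$ and every vertex stabiliser in $\operatorname{Aut}\Gamma$ is trivial. **Theorem.** Let $\Gamma$ be a vertex-transitive directed graph with connectivity one. Then $\Gamma$ is primitive if and only if every block of $\Gamma$ is primitive, is not automorphism-regular and has at least three vertices, and any two blocks of $\Gamma$ are isomorphic as directed graphs. -/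

import Mathlib

namespace Digraph

/-- The automorphism group of a directed graph: permutations of the vertices preserving and
reflecting the edge relation. It acts on the vertices by evaluation. -/
abbrev Aut {V : Type*} (Γ : Digraph V) : Type _ := Γ.Adj ≃r Γ.Adj

/-- Any two vertices are joined by an undirected path. (The empty graph qualifies.) -/
def IsConn {V : Type*} (Γ : Digraph V) : Prop :=
  Γ.toSimpleGraphInclusive.Preconnected

/-- The directed graph induced on a set of vertices. -/
def induce {V : Type*} (Γ : Digraph V) (s : Set V) : Digraph s where
  Adj a b := Γ.Adj a b

/-- The graph is connected, and deleting some vertex leaves a disconnected induced graph. -/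
def HasConnectivityOne {V : Type*} (Γ : Digraph V) : Prop :=
  Γ.IsConn ∧ ∃ α : V, ¬ (Γ.induce {α}ᶜ).IsConn

/-- The automorphism group is transitive on the vertices. -/
def IsVertexTransitive {V : Type*} (Γ : Digraph V) : Prop :=
  MulAction.IsPretransitive Γ.Aut V

/-- The automorphism group is primitive on the vertices: it is transitive and preserves no
equivalence relation other than the trivial and the universal one. -/
def IsPrimitive {V : Type*} (Γ : Digraph V) : Prop :=
  MulAction.IsPreprimitive Γ.Aut V

/-- The automorphism group is regular on the vertices: it is transitive, with trivial vertex
stabilisers. -/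
def IsAutRegular {V : Type*} (Γ : Digraph V) : Prop :=
  MulAction.IsPretransitive Γ.Aut V ∧ ∀ α : V, MulAction.stabilizer Γ.Aut α = ⊥

/-- A (not necessarily induced) subgraph: a set of vertices and a set of edges of `Γ` between
vertices of that set. -/
@[ext]
structure Subgraph {V : Type*} (Γ : Digraph V) where
  verts : Set V
  Adj : V → V → Prop
  adj_sub : ∀ {a b : V}, Adj a b → Γ.Adj a b
  left_mem : ∀ {a b : V}, Adj a b → a ∈ verts
  right_mem : ∀ {a b : V}, Adj a b → b ∈ verts

namespace Subgraph

instance {V : Type*} (Γ : Digraph V) : PartialOrder Γ.Subgraph where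
  le Λ₁ Λ₂ := Λ₁.verts ⊆ Λ₂.verts ∧ ∀ a b : V, Λ₁.Adj a b → Λ₂.Adj a b
  le_refl _ := ⟨fun _ h => h, fun _ _ h => h⟩
  le_trans _ _ _ h₁ h₂ := ⟨fun _ h => h₂.1 (h₁.1 h), fun a b h => h₂.2 a b (h₁.2 a b h)⟩
  le_antisymm Λ₁ Λ₂ h₁ h₂ := Subgraph.ext (Set.Subset.antisymm h₁.1 h₂.1)
    (funext fun a => funext fun b => propext ⟨h₁.2 a b, h₂.2 a b⟩)

/-- A subgraph, regarded as a directed graph on its own vertex set. -/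
def toDigraph {V : Type*} {Γ : Digraph V} (Λ : Γ.Subgraph) : Digraph Λ.verts where
  Adj a b := Λ.Adj a b

/-- A block: a connected subgraph that is maximal subject to not having connectivity one. -/
def IsBlock {V : Type*} {Γ : Digraph V} (Λ : Γ.Subgraph) : Prop :=
  Maximal (fun Δ : Γ.Subgraph => Δ.toDigraph.IsConn ∧ ¬ Δ.toDigraph.HasConnectivityOne) Λ

end Subgraph

end Digraph

/-!
The blocks of a connected graph are arranged like a tree. Every vertex `v` has a unique gate in
every block `B`, the vertex of `B` reached from `v` without using an edge of `B`. It is unique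
because a path between two vertices of `B` stays in `B`
(`SimpleGraph.IsBlockSet.support_subset`), the union of `B` with such a path being nonseparable.
The gate in `B` is constant on all other blocks and commutes with automorphisms. For `v ≠ r`
exactly one block at `v` leads towards `r`, that is, does not have `v` as the gate of `r`
(`SimpleGraph.existsUnique_gate_ne`). As the graph is vertex-transitive, every vertex
is a cut vertex and lies in at least two blocks.

Suppose that `Γ` is primitive. Given an equivalence relation on a block `B`, call two vertices of
`Γ` related if, under every automorphism, the gates of their images in `B` are related. This is an
invariant relation on `Γ`, so it is trivial or universal. Applied to equality on `B`, it shows that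
all blocks lie in one orbit (`Digraph.IsPrimitive.exists_image_eq`); applied to an invariant
relation on `B`, it shows that the relation is trivial or universal
(`Digraph.IsPrimitive.eq_or_forall_induce`). Next, if each block carried a difference function with
values in an abelian group, invariant under automorphisms, then the differences of gates could be
multiplied over all blocks, and the vertices with trivial difference would form a nontrivial
invariant relation on `Γ` (`Digraph.not_isPrimitive_of_cocycle`). Blocks with two vertices have such
differences in `ℤ/2`, and blocks with a primitive regular group have them in that group, which is
abelian as it has no proper nontrivial subgroups. So neither kind of block occurs.

Conversely, if the blocks are pairwise isomorphic and vertex-transitive, every isomorphism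
between two blocks extends to `Γ` by recursion along the tree of blocks
(`Digraph.exists_aut_extending`). Let an invariant relation relate `x` to `y ≠ x`, let `B` be the
block at `y` leading to `x`, and let `a ≠ y` be the gate of `x` in `B`. As `B` is primitive but
not regular, the stabiliser of `a` in its automorphism group moves `y`. Extending by the identity on
everything attached to `B` at `a`, one finds `y` related to a second vertex of `B`. So all of `B` is
related because `B` is primitive, then every block is by the extension property, and then all of `Γ`
is by connectivity (`Digraph.isPrimitive_of_blocks`).
-/

/-! ### Nonseparable sets and blocks of a simple graph -/

namespace SimpleGraph

/-- A graph is connected exactly when every two-valued function that is constant along edges is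
constant. Connectivity is tested in this form below, since such functions restrict to subsets. -/
theorem preconnected_iff_forall_prop {W : Type*} (H : SimpleGraph W) :
    H.Preconnected ↔
      ∀ f : W → Prop, (∀ x y, H.Adj x y → (f x ↔ f y)) → ∀ x y, f x ↔ f y := by
  constructor
  · intro h f hf x y
    obtain ⟨p⟩ := h x y
    induction p with
    | nil => rfl
    | cons hadj _ ih => exact (hf _ _ hadj).trans ih
  · intro h x y
    refine (h (fun z => H.Reachable x z) (fun u v huv => ?_) x y).1 (Reachable.refl x)
    exact ⟨fun hu => hu.trans huv.reachable, fun hv => hv.trans huv.symm.reachable⟩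

variable {V : Type*} {G : SimpleGraph V} {B B₁ B₂ S : Set V}

theorem preconnected_induce_iff_forall_prop :
    (G.induce S).Preconnected ↔ ∀ f : V → Prop,
      (∀ x ∈ S, ∀ y ∈ S, G.Adj x y → (f x ↔ f y)) → ∀ x ∈ S, ∀ y ∈ S, f x ↔ f y := by
  rw [preconnected_iff_forall_prop]
  constructor
  · intro h f hf x hx y hy
    exact h (fun z => f z) (fun a b hab => hf a a.2 b b.2 hab) ⟨x, hx⟩ ⟨y, hy⟩
  · intro h f hf x y
    have := h (fun v => ∃ hv : v ∈ S, f ⟨v, hv⟩) (fun a ha b hb hab => by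
      simpa [ha, hb] using hf ⟨a, ha⟩ ⟨b, hb⟩ hab) x x.2 y y.2
    simpa using this

/-- Any function that is constant along the edges inside a connected set is constant on it. -/
theorem eq_of_preconnected_induce {α : Type*} (hS : (G.induce S).Preconnected) (f : V → α)
    (hf : ∀ x ∈ S, ∀ y ∈ S, G.Adj x y → f x = f y) {x y : V} (hx : x ∈ S) (hy : y ∈ S) :
    f x = f y :=
  (preconnected_induce_iff_forall_prop.1 hS (fun v => f x = f v)
    (fun a ha b hb hab => by rw [hf a ha b hb hab]) x hx y hy).1 rfl

variable (G) in
/-- A set of vertices is nonseparable if it induces a connected graph, and still does so after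
any one vertex is deleted. -/
def Nonseparable (S : Set V) : Prop :=
  (G.induce S).Preconnected ∧ ∀ a : V, (G.induce (S \ {a})).Preconnected

variable (G) in
/-- The vertex set of a block: a maximal nonseparable set. -/
def IsBlockSet (B : Set V) : Prop :=
  Maximal G.Nonseparable B

theorem nonseparable_pair {x y : V} (h : G.Adj x y) : G.Nonseparable {x, y} := by
  constructor
  · rw [preconnected_induce_iff_forall_prop]
    rintro f hf
    have := hf x (by simp) y (by simp) h
    rintro a (rfl | rfl) b (rfl | rfl) <;> simp [this]
  · intro a
    rw [preconnected_induce_iff_forall_prop]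
    rintro f hf u ⟨(rfl | rfl), hu⟩ v ⟨(rfl | rfl), hv⟩
    · rfl
    · exact hf _ ⟨by simp, hu⟩ _ ⟨by simp, hv⟩ h
    · exact hf _ ⟨by simp, hu⟩ _ ⟨by simp, hv⟩ h.symm
    · rfl

/-- A union of nonseparable sets that all contain the same two distinct vertices is
nonseparable: at most one of the two vertices is deleted, and the other holds the union together. -/
theorem nonseparable_sUnion {C : Set (Set V)} {x y : V} (hxy : x ≠ y)
    (hC : ∀ S ∈ C, G.Nonseparable S ∧ x ∈ S ∧ y ∈ S) : G.Nonseparable (⋃₀ C) := by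
  constructor
  · rw [preconnected_induce_iff_forall_prop]
    have key : ∀ f : V → Prop,
        (∀ x ∈ ⋃₀ C, ∀ y ∈ ⋃₀ C, G.Adj x y → (f x ↔ f y)) → ∀ u ∈ ⋃₀ C, (f u ↔ f x) := by
      rintro f hf u ⟨S, hS, hu⟩
      exact preconnected_induce_iff_forall_prop.1 (hC S hS).1.1 f
        (fun a ha b hb => hf a ⟨S, hS, ha⟩ b ⟨S, hS, hb⟩) u hu x (hC S hS).2.1
    exact fun f hf u hu v hv => (key f hf u hu).trans (key f hf v hv).symm
  · intro a
    obtain ⟨z, hza, hz⟩ : ∃ z, z ≠ a ∧ ∀ S ∈ C, z ∈ S := by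
      by_cases h : x = a
      · exact ⟨y, fun h' => hxy (h.trans h'.symm), fun S hS => (hC S hS).2.2⟩
      · exact ⟨x, h, fun S hS => (hC S hS).2.1⟩
    rw [preconnected_induce_iff_forall_prop]
    have key : ∀ f : V → Prop,
        (∀ x ∈ ⋃₀ C \ {a}, ∀ y ∈ ⋃₀ C \ {a}, G.Adj x y → (f x ↔ f y)) →
          ∀ u ∈ ⋃₀ C \ {a}, (f u ↔ f z) := by
      rintro f hf u ⟨⟨S, hS, hu⟩, hua⟩
      exact preconnected_induce_iff_forall_prop.1 ((hC S hS).1.2 a) f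
        (fun b hb c hc => hf b ⟨⟨S, hS, hb.1⟩, hb.2⟩ c ⟨⟨S, hS, hc.1⟩, hc.2⟩) u ⟨hu, hua⟩ z
        ⟨hz S hS, hza⟩
    exact fun f hf u hu v hv => (key f hf u hu).trans (key f hf v hv).symm

theorem exists_isBlockSet_of_adj {x y : V} (h : G.Adj x y) :
    ∃ B, G.IsBlockSet B ∧ x ∈ B ∧ y ∈ B := by
  set C : Set (Set V) := {S | G.Nonseparable S ∧ x ∈ S ∧ y ∈ S} with hC
  have hpair : ({x, y} : Set V) ∈ C := ⟨nonseparable_pair h, by simp, by simp⟩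
  have hx : x ∈ ⋃₀ C := ⟨_, hpair, by simp⟩
  have hy : y ∈ ⋃₀ C := ⟨_, hpair, by simp⟩
  refine ⟨⋃₀ C, ⟨nonseparable_sUnion h.ne (fun S hS => hS), fun T hT hle => ?_⟩, hx, hy⟩
  exact Set.subset_sUnion_of_mem ⟨hT, hle hx, hle hy⟩

theorem IsBlockSet.eq_of_mem (h₁ : G.IsBlockSet B₁) (h₂ : G.IsBlockSet B₂) {x y : V}
    (hxy : x ≠ y) (hx₁ : x ∈ B₁) (hy₁ : y ∈ B₁) (hx₂ : x ∈ B₂) (hy₂ : y ∈ B₂) : B₁ = B₂ := by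
  have hU : G.Nonseparable (⋃₀ {B₁, B₂}) := by
    refine nonseparable_sUnion hxy ?_
    rintro S (rfl | rfl)
    · exact ⟨h₁.1, hx₁, hy₁⟩
    · exact ⟨h₂.1, hx₂, hy₂⟩
  have s₁ : B₁ ⊆ ⋃₀ {B₁, B₂} := Set.subset_sUnion_of_mem (by simp)
  have s₂ : B₂ ⊆ ⋃₀ {B₁, B₂} := Set.subset_sUnion_of_mem (by simp)
  exact Set.Subset.antisymm (s₁.trans (h₂.2 hU s₂)) (s₂.trans (h₁.2 hU s₁))

theorem IsBlockSet.eq_of_mem_of_ne (h₁ : G.IsBlockSet B₁) (h₂ : G.IsBlockSet B₂) (hne : B₁ ≠ B₂)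
    {x y : V} (hx₁ : x ∈ B₁) (hy₁ : y ∈ B₁) (hx₂ : x ∈ B₂) (hy₂ : y ∈ B₂) : x = y := by
  by_contra h
  exact hne (h₁.eq_of_mem h₂ h hx₁ hy₁ hx₂ hy₂)

theorem Walk.iff_of_forall_adj {f : V → Prop} {u v : V} (p : G.Walk u v)
    (hf : ∀ x ∈ p.support, ∀ y ∈ p.support, G.Adj x y → (f x ↔ f y)) : f u ↔ f v := by
  induction p with
  | nil => rfl
  | cons h p ih =>
    refine (hf _ (by simp) _ (by simp) h).trans (ih fun x hx y hy => ?_)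
    exact hf x (by simp [hx]) y (by simp [hy])

/-- Attaching a path to a nonseparable set by its two ends leaves it nonseparable:
whichever vertex is deleted, each remaining vertex of the path still reaches one of the ends. -/
theorem Nonseparable.union_support (hS : G.Nonseparable S) {x y : V} (hx : x ∈ S) (hy : y ∈ S)
    {p : G.Walk x y} (hp : p.IsPath) :
    G.Nonseparable (S ∪ {v | v ∈ p.support}) := by
  classical
  constructor
  · rw [preconnected_induce_iff_forall_prop]
    intro f hf
    have key : ∀ u ∈ S ∪ {v | v ∈ p.support}, (f u ↔ f x) := by
      rintro u (hu | hu)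
      · exact preconnected_induce_iff_forall_prop.1 hS.1 f
          (fun a ha b hb => hf a (.inl ha) b (.inl hb)) u hu x hx
      · refine ((p.takeUntil u hu).iff_of_forall_adj fun a ha b hb => ?_).symm
        exact hf a (.inr (p.support_takeUntil_subset_support hu ha))
          b (.inr (p.support_takeUntil_subset_support hu hb))
    exact fun u hu v hv => (key u hu).trans (key v hv).symm
  · intro c
    rw [preconnected_induce_iff_forall_prop]
    intro f hf
    have hSc : ∀ u ∈ S \ {c}, ∀ v ∈ S \ {c}, (f u ↔ f v) :=
      preconnected_induce_iff_forall_prop.1 (hS.2 c) f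
        (fun a ha b hb => hf a ⟨.inl ha.1, ha.2⟩ b ⟨.inl hb.1, hb.2⟩)
    have key : ∀ u ∈ (S ∪ {v | v ∈ p.support}) \ {c}, ∃ w ∈ S \ {c}, (f u ↔ f w) := by
      rintro u ⟨hu | hu, huc⟩
      · exact ⟨u, ⟨hu, huc⟩, Iff.rfl⟩
      · by_cases hc : c ∈ (p.takeUntil u hu).support
        · have hd : c ∉ (p.dropUntil u hu).support := by
            intro hd
            have hnd := hp.support_nodup
            rw [← p.take_spec hu, Walk.support_append] at hnd
            have hdisj := List.disjoint_of_nodup_append hnd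
            rw [← Walk.cons_tail_support] at hd
            rcases List.mem_cons.1 hd with h | h
            · exact huc h.symm
            · exact hdisj hc h
          refine ⟨y, ⟨hy, fun h => hd (h ▸ Walk.end_mem_support _)⟩,
            (p.dropUntil u hu).iff_of_forall_adj fun a ha b hb => ?_⟩
          exact hf a ⟨.inr (p.support_dropUntil_subset_support hu ha), fun h => hd (h ▸ ha)⟩
            b ⟨.inr (p.support_dropUntil_subset_support hu hb), fun h => hd (h ▸ hb)⟩
        · refine ⟨x, ⟨hx, fun h => hc (h ▸ Walk.start_mem_support _)⟩,
            ((p.takeUntil u hu).iff_of_forall_adj fun a ha b hb => ?_).symm⟩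
          exact hf a ⟨.inr (p.support_takeUntil_subset_support hu ha), fun h => hc (h ▸ ha)⟩
            b ⟨.inr (p.support_takeUntil_subset_support hu hb), fun h => hc (h ▸ hb)⟩
    intro u hu v hv
    obtain ⟨u', hu', h₁⟩ := key u hu
    obtain ⟨v', hv', h₂⟩ := key v hv
    exact h₁.trans ((hSc u' hu' v' hv').trans h₂.symm)

theorem IsBlockSet.support_subset (hB : G.IsBlockSet B) {x y : V} (hx : x ∈ B) (hy : y ∈ B)
    {p : G.Walk x y} (hp : p.IsPath) : ∀ v ∈ p.support, v ∈ B :=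
  fun _ hv => hB.2 (hB.1.union_support hx hy hp) Set.subset_union_left (.inr hv)

theorem IsBlockSet.nontrivial (hG : G.Connected) [Nontrivial V] (hB : G.IsBlockSet B) :
    B.Nontrivial := by
  by_contra h
  rw [Set.not_nontrivial_iff] at h
  obtain ⟨x, hx⟩ : ∃ x, B ⊆ {x} := by
    rcases h.eq_empty_or_singleton with h | ⟨x, h⟩
    · exact ⟨hG.nonempty.some, by simp [h]⟩
    · exact ⟨x, h.le⟩
  obtain ⟨y, hy⟩ := hG.preconnected.exists_adj_of_nontrivial x
  have := hB.2 (nonseparable_pair hy) (hx.trans (by simp))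
  exact hy.ne ((hx (this (by simp : x ∈ ({x, y} : Set V)))).trans
    (hx (this (by simp : y ∈ ({x, y} : Set V)))).symm)

/-! ### The gate of a vertex in a block -/

variable (G) in
/-- The graph `G` with all edges inside the set `B` removed. -/
def outside (B : Set V) : SimpleGraph V where
  Adj x y := G.Adj x y ∧ ¬ (x ∈ B ∧ y ∈ B)
  symm := ⟨fun _ _ h => ⟨h.1.symm, fun h' => h.2 h'.symm⟩⟩
  loopless := ⟨fun _ h => h.1.ne rfl⟩

theorem outside_le : G.outside B ≤ G := fun _ _ h => h.1

open Classical in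
variable (G) in
/-- The gate of a vertex `v` in a block `B`: the vertex of `B` that can be reached from `v`
without using an edge of `B`. (When there is no such vertex, it is `v` itself.) -/
noncomputable def gate (B : Set V) (v : V) : V :=
  if h : ∃ b ∈ B, (G.outside B).Reachable v b then h.choose else v

theorem exists_reachable_outside (hG : G.Connected) (hB : B.Nonempty) (v : V) :
    ∃ b ∈ B, (G.outside B).Reachable v b := by
  obtain ⟨b, hb⟩ := hB
  obtain ⟨p⟩ := hG.preconnected v b
  induction p with
  | nil => exact ⟨_, hb, Reachable.refl _⟩
  | @cons u v w h p ih =>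
    obtain ⟨c, hc, hvc⟩ := ih hb
    by_cases h' : u ∈ B ∧ v ∈ B
    · exact ⟨u, h'.1, Reachable.refl _⟩
    · exact ⟨c, hc, (show (G.outside B).Adj u v from ⟨h, h'⟩).reachable.trans hvc⟩

/-- Two vertices of a block are not joined outside it: a path joining them would have to lie
inside the block. -/
theorem IsBlockSet.eq_of_reachable_outside (hB : G.IsBlockSet B) {x y : V} (hx : x ∈ B)
    (hy : y ∈ B) (h : (G.outside B).Reachable x y) : x = y := by
  by_contra hxy
  obtain ⟨p, hp⟩ := h.exists_isPath
  have hsub := hB.support_subset hx hy (hp.mapLe outside_le)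
  cases p with
  | nil => exact hxy rfl
  | cons hadj p => exact hadj.2 ⟨hx, hsub _ (by simp)⟩

theorem gate_mem_and_reachable (hG : G.Connected) (hB : B.Nonempty) (v : V) :
    G.gate B v ∈ B ∧ (G.outside B).Reachable v (G.gate B v) := by
  have h := exists_reachable_outside hG hB v
  rw [gate, dif_pos h]
  exact h.choose_spec

section Gate

variable [Nontrivial V] (hG : G.Connected)
include hG

theorem IsBlockSet.gate_mem (hB : G.IsBlockSet B) (v : V) : G.gate B v ∈ B :=
  (gate_mem_and_reachable hG (hB.nontrivial hG).nonempty v).1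

theorem IsBlockSet.gate_eq (hB : G.IsBlockSet B) {v b : V} (hb : b ∈ B)
    (h : (G.outside B).Reachable v b) : G.gate B v = b := by
  have := gate_mem_and_reachable hG (hB.nontrivial hG).nonempty v
  exact hB.eq_of_reachable_outside this.1 hb (this.2.symm.trans h)

theorem IsBlockSet.gate_of_mem (hB : G.IsBlockSet B) {v : V} (hv : v ∈ B) : G.gate B v = v :=
  hB.gate_eq hG hv (Reachable.refl v)

theorem IsBlockSet.gate_eq_of_adj (hB : G.IsBlockSet B) {v w : V} (h : G.Adj v w)
    (hvw : ¬ (v ∈ B ∧ w ∈ B)) : G.gate B v = G.gate B w := by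
  have := gate_mem_and_reachable hG (hB.nontrivial hG).nonempty w
  exact hB.gate_eq hG this.1 ((show (G.outside B).Adj v w from ⟨h, hvw⟩).reachable.trans this.2)

/-- The gate in one block is constant on every other block. -/
theorem IsBlockSet.gate_eq_of_ne (h₁ : G.IsBlockSet B₁) (h₂ : G.IsBlockSet B₂) (hne : B₁ ≠ B₂)
    {x y : V} (hx : x ∈ B₂) (hy : y ∈ B₂) : G.gate B₁ x = G.gate B₁ y := by
  refine eq_of_preconnected_induce h₂.1.1 (G.gate B₁) (fun u hu v hv huv => ?_) hx hy
  exact h₁.gate_eq_of_adj hG huv fun h => huv.ne (h₁.eq_of_mem_of_ne h₂ hne h.1 h.2 hu hv)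

/-- A walk leading to a vertex with another gate passes through the gate of its start. -/
theorem IsBlockSet.gate_mem_support (hB : G.IsBlockSet B) {u v : V} (p : G.Walk u v)
    (h : G.gate B u ≠ G.gate B v) : G.gate B u ∈ p.support := by
  induction p with
  | nil => exact absurd rfl h
  | @cons a b c hab p ih =>
    by_cases h' : a ∈ B ∧ b ∈ B
    · simp [hB.gate_of_mem hG h'.1]
    · have := hB.gate_eq_of_adj hG hab h'
      rw [this] at h ⊢
      simp [ih h]

/-- For distinct vertices `r` and `v` exactly one block at `v` leads towards `r`. -/
theorem existsUnique_gate_ne (r : V) {v : V} (hv : v ≠ r) :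
    ∃! B, G.IsBlockSet B ∧ v ∈ B ∧ G.gate B r ≠ v := by
  classical
  obtain ⟨p, hp⟩ := (hG.preconnected v r).exists_isPath
  cases p with
  | nil => exact absurd rfl hv
  | @cons _ w _ h p =>
    rw [Walk.cons_isPath_iff] at hp
    obtain ⟨B, hB, hvB, hwB⟩ := exists_isBlockSet_of_adj h
    have hBr : G.gate B r ≠ v := by
      intro hr
      have := hB.gate_mem_support hG p.reverse (by
        rw [hr, hB.gate_of_mem hG hwB]; exact h.ne)
      rw [hr] at this
      exact hp.2 (by simpa using this)
    refine ⟨B, ⟨hB, hvB, hBr⟩, ?_⟩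
    rintro B' ⟨hB', hvB', hBr'⟩
    by_contra hne
    -- A path from `r` that avoids all edges of `B'` and ends at the gate `b'` of `r` in `B'`
    -- would have to run through `v`, but then `v` itself would have gate `b'`.
    obtain ⟨hb', ⟨q⟩⟩ := gate_mem_and_reachable hG (hB'.nontrivial hG).nonempty r
    set b' := G.gate B' r
    have h1 : G.gate B b' = v := by
      rw [hB.gate_eq_of_ne hG hB' (Ne.symm hne) hb' hvB', hB.gate_of_mem hG hvB]
    have hmem : v ∈ (q.mapLe outside_le).reverse.support := by
      have := hB.gate_mem_support hG (q.mapLe outside_le).reverse (by rw [h1]; exact hBr.symm)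
      rwa [h1] at this
    have hmem' : v ∈ q.support := by simpa using hmem
    have h2 : G.gate B' v = b' := hB'.gate_eq hG hb' ⟨q.dropUntil v hmem'⟩
    rw [hB'.gate_of_mem hG hvB'] at h2
    exact hBr' h2.symm

open Classical in
theorem IsBlockSet.dist_gate_lt (hB : G.IsBlockSet B) {r v : V} (hv : v ∈ B)
    (h : G.gate B r ≠ v) : G.dist r (G.gate B r) < G.dist r v := by
  obtain ⟨p, hp⟩ := hG.exists_walk_length_eq_dist r v
  have hmem := hB.gate_mem_support hG p (by rwa [hB.gate_of_mem hG hv])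
  have h1 := dist_le (p.takeUntil _ hmem)
  have h2 := p.length_takeUntil_lt_length hmem h
  omega

/-- Only finitely many blocks separate two given vertices. -/
theorem finite_gate_ne (x y : V) :
    {B | G.IsBlockSet B ∧ G.gate B x ≠ G.gate B y}.Finite := by
  obtain ⟨p⟩ := hG.preconnected x y
  induction p with
  | nil => simp
  | @cons u v w h p ih =>
    obtain ⟨B, hB, hu, hv⟩ := exists_isBlockSet_of_adj h
    refine (ih.insert B).subset ?_
    rintro C ⟨hC, hne⟩
    by_cases hCB : C = B
    · exact .inl hCB
    · exact .inr ⟨hC, fun h' => hne ((hC.gate_eq_of_ne hG hB hCB hu hv).trans h')⟩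

end Gate

/-- A cut vertex lies in two blocks: if `a` lies in a single block, every other vertex is joined
to a vertex of that block other than `a` without passing through `a`. -/
theorem exists_ne_isBlockSet_of_not_preconnected [Nontrivial V] (hG : G.Connected) {a : V}
    (ha : ¬ (G.induce {a}ᶜ).Preconnected) :
    ∃ B₁ B₂, G.IsBlockSet B₁ ∧ G.IsBlockSet B₂ ∧ B₁ ≠ B₂ ∧ a ∈ B₁ ∧ a ∈ B₂ := by
  classical
  by_contra! hcon
  obtain ⟨c, hc⟩ := hG.preconnected.exists_adj_of_nontrivial a
  obtain ⟨B, hB, haB, -⟩ := exists_isBlockSet_of_adj hc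
  apply ha
  rw [preconnected_induce_iff_forall_prop]
  intro f hf
  have hgate : ∀ v ∈ ({a}ᶜ : Set V), G.gate B v ∈ B \ {a} ∧ (f v ↔ f (G.gate B v)) := by
    intro v hv
    obtain ⟨B', ⟨hB', haB', hne⟩, -⟩ := existsUnique_gate_ne hG v (Ne.symm hv)
    obtain rfl : B' = B := by
      by_contra hne'
      exact hcon B' B hB' hB hne' haB' haB
    refine ⟨⟨hB.gate_mem hG v, hne⟩, ?_⟩
    obtain ⟨hmem, ⟨p⟩⟩ := gate_mem_and_reachable hG (hB.nontrivial hG).nonempty v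
    have hp : ∀ x ∈ p.support, x ≠ a := by
      rintro x hx rfl
      exact hne (hB.eq_of_reachable_outside hmem haB ⟨(p.dropUntil x hx).reverse⟩)
    exact p.iff_of_forall_adj fun x hx y hy hxy => hf x (hp x hx) y (hp y hy) hxy.1
  intro x hx y hy
  refine (hgate x hx).2.trans (Iff.trans ?_ (hgate y hy).2.symm)
  exact preconnected_induce_iff_forall_prop.1 (hB.1.2 a) f
    (fun u hu v hv => hf u hu.2 v hv.2) _ (hgate x hx).1 _ (hgate y hy).1

/-! ### Blocks under isomorphisms -/

theorem preconnected_induce_image (φ : G ≃g G) (h : (G.induce S).Preconnected) :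
    (G.induce (φ '' S)).Preconnected := by
  rw [preconnected_induce_iff_forall_prop] at h ⊢
  rintro f hf _ ⟨x, hx, rfl⟩ _ ⟨y, hy, rfl⟩
  exact h (fun v => f (φ v)) (fun a ha b hb hab => hf _ ⟨a, ha, rfl⟩ _ ⟨b, hb, rfl⟩
    (φ.map_adj_iff.2 hab)) x hx y hy

theorem Nonseparable.image (hS : G.Nonseparable S) (φ : G ≃g G) : G.Nonseparable (φ '' S) := by
  refine ⟨preconnected_induce_image φ hS.1, fun a => ?_⟩
  have := preconnected_induce_image φ (hS.2 (φ.symm a))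
  rwa [Set.image_sdiff φ.injective, Set.image_singleton, RelIso.apply_symm_apply] at this

theorem IsBlockSet.image (hB : G.IsBlockSet B) (φ : G ≃g G) : G.IsBlockSet (φ '' B) := by
  refine ⟨hB.1.image φ, fun T hT hle => ?_⟩
  have h := hB.2 (hT.image φ.symm) (fun x hx => ⟨φ x, hle ⟨x, hx, rfl⟩, by simp⟩)
  exact fun x hx => ⟨φ.symm x, h ⟨x, hx, rfl⟩, by simp⟩

theorem IsBlockSet.gate_image [Nontrivial V] (hG : G.Connected) (hB : G.IsBlockSet B)
    (φ : G ≃g G) (v : V) : G.gate (φ '' B) (φ v) = φ (G.gate B v) := by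
  obtain ⟨hmem, hr⟩ := gate_mem_and_reachable hG (hB.nontrivial hG).nonempty v
  refine (hB.image φ).gate_eq hG ⟨_, hmem, rfl⟩ ?_
  refine hr.map (⟨φ, fun {a b} h => ⟨φ.map_adj_iff.2 h.1, fun h' => h.2 ?_⟩⟩ :
    G.outside B →g G.outside (φ '' B))
  simpa using h'

end SimpleGraph

/-! ### Blocks of a directed graph -/

namespace Digraph

variable {V : Type*} {Γ : Digraph V}

theorem isConn_iff_forall_prop :
    Γ.IsConn ↔ ∀ f : V → Prop, (∀ x y, Γ.Adj x y → (f x ↔ f y)) → ∀ x y, f x ↔ f y := by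
  rw [IsConn, SimpleGraph.preconnected_iff_forall_prop]
  refine forall_congr' fun f => imp_congr_left ?_
  constructor
  · intro h x y hxy
    by_cases hne : x = y
    · rw [hne]
    · exact h x y ⟨hne, .inl hxy⟩
  · rintro h x y ⟨-, hxy | hxy⟩
    · exact h x y hxy
    · exact (h y x hxy).symm

theorem isConn_induce_iff {s : Set V} :
    (Γ.induce s).IsConn ↔ (Γ.toSimpleGraphInclusive.induce s).Preconnected := by
  rw [isConn_iff_forall_prop, SimpleGraph.preconnected_iff_forall_prop]
  refine forall_congr' fun f => imp_congr_left ?_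
  constructor
  · rintro h x y ⟨-, hxy | hxy⟩
    · exact h x y hxy
    · exact (h y x hxy).symm
  · intro h x y hxy
    by_cases hne : x = y
    · rw [hne]
    · exact h x y ⟨fun h' => hne (Subtype.ext h'), .inl hxy⟩

namespace Subgraph

/-- The subgraph induced on a set of vertices. -/
def full (Γ : Digraph V) (s : Set V) : Γ.Subgraph where
  verts := s
  Adj a b := a ∈ s ∧ b ∈ s ∧ Γ.Adj a b
  adj_sub h := h.2.2
  left_mem h := h.1
  right_mem h := h.2.1

theorem toDigraph_full (s : Set V) : (full Γ s).toDigraph = Γ.induce s := by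
  ext a b
  exact ⟨fun h => h.2.2, fun h => ⟨a.2, b.2, h⟩⟩

theorem le_full (Λ : Γ.Subgraph) : Λ ≤ full Γ Λ.verts :=
  ⟨fun _ h => h, fun _ _ h => ⟨Λ.left_mem h, Λ.right_mem h, Λ.adj_sub h⟩⟩

/-- A subgraph that is connected and does not have connectivity one has a nonseparable vertex
set, because the whole graph has all edges of the subgraph. -/
theorem nonseparable_verts {Λ : Γ.Subgraph}
    (h : Λ.toDigraph.IsConn ∧ ¬ Λ.toDigraph.HasConnectivityOne) :
    Γ.toSimpleGraphInclusive.Nonseparable Λ.verts := by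
  obtain ⟨hc, h1⟩ := h
  have hcon : (Γ.toSimpleGraphInclusive.induce Λ.verts).Preconnected := by
    rw [← isConn_induce_iff, isConn_iff_forall_prop]
    rw [isConn_iff_forall_prop] at hc
    exact fun f hf => hc f fun x y hxy => hf x y (Λ.adj_sub hxy)
  refine ⟨hcon, fun a => ?_⟩
  by_cases ha : a ∈ Λ.verts
  · have h2 : (Λ.toDigraph.induce {⟨a, ha⟩}ᶜ).IsConn := by
      by_contra h2
      exact h1 ⟨hc, _, h2⟩
    rw [isConn_iff_forall_prop] at h2
    rw [← isConn_induce_iff, isConn_iff_forall_prop]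
    intro f hf x y
    refine h2 (fun v => f ⟨v, v.1.2, fun h => v.2 (Subtype.ext h)⟩)
      (fun u v huv => hf _ _ (Λ.adj_sub huv))
      ⟨⟨x, x.2.1⟩, fun h => x.2.2 (congrArg Subtype.val h)⟩
      ⟨⟨y, y.2.1⟩, fun h => y.2.2 (congrArg Subtype.val h)⟩
  · rwa [Set.sdiff_singleton_eq_self ha]

theorem full_of_nonseparable {s : Set V} (h : Γ.toSimpleGraphInclusive.Nonseparable s) :
    (full Γ s).toDigraph.IsConn ∧ ¬ (full Γ s).toDigraph.HasConnectivityOne := by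
  rw [toDigraph_full]
  refine ⟨isConn_induce_iff.2 h.1, ?_⟩
  rintro ⟨-, a, ha⟩
  apply ha
  have h2 := h.2 a
  rw [← isConn_induce_iff, isConn_iff_forall_prop] at h2
  rw [isConn_iff_forall_prop]
  intro f hf x y
  refine (h2 (fun v => f ⟨⟨v, v.2.1⟩, fun h => v.2.2 (congrArg Subtype.val h)⟩)
    (fun u v huv => hf _ _ huv) ⟨x, x.1.2, fun h => x.2 (Subtype.ext h)⟩
    ⟨y, y.1.2, fun h => y.2 (Subtype.ext h)⟩)

theorem isBlock_full {B : Set V} (hB : Γ.toSimpleGraphInclusive.IsBlockSet B) :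
    (full Γ B).IsBlock := by
  refine ⟨full_of_nonseparable hB.1, fun Δ hΔ hle => ?_⟩
  obtain rfl : Δ.verts = B :=
    Set.Subset.antisymm (hB.2 (nonseparable_verts hΔ) hle.1) hle.1
  exact Δ.le_full

theorem IsBlock.isBlockSet {Λ : Γ.Subgraph} (hΛ : Λ.IsBlock) :
    Γ.toSimpleGraphInclusive.IsBlockSet Λ.verts := by
  refine ⟨nonseparable_verts hΛ.1, fun T hT hle => ?_⟩
  have hle' : Λ ≤ full Γ T :=
    ⟨hle, fun a b h => ⟨hle (Λ.left_mem h), hle (Λ.right_mem h), Λ.adj_sub h⟩⟩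
  exact (hΛ.2 (full_of_nonseparable hT) hle').1

theorem IsBlock.toDigraph_eq {Λ : Γ.Subgraph} (hΛ : Λ.IsBlock) :
    Λ.toDigraph = Γ.induce Λ.verts := by
  ext a b
  constructor
  · exact fun h => Λ.adj_sub h
  · intro h
    exact (hΛ.2 (full_of_nonseparable (nonseparable_verts hΛ.1)) Λ.le_full).2 a b ⟨a.2, b.2, h⟩

end Subgraph

/-! ### The action of automorphisms on blocks -/

/-- An automorphism of a directed graph, as an automorphism of the underlying graph. -/
def Aut.toGraphIso (g : Γ.Aut) : Γ.toSimpleGraphInclusive ≃g Γ.toSimpleGraphInclusive where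
  toEquiv := g.toEquiv
  map_rel_iff' := by
    intro a b
    change (g a ≠ g b ∧ (Γ.Adj (g a) (g b) ∨ Γ.Adj (g b) (g a))) ↔
      (a ≠ b ∧ (Γ.Adj a b ∨ Γ.Adj b a))
    rw [g.map_rel_iff, g.map_rel_iff, g.injective.ne_iff]

theorem isBlockSet_image {B : Set V} (hB : Γ.toSimpleGraphInclusive.IsBlockSet B) (g : Γ.Aut) :
    Γ.toSimpleGraphInclusive.IsBlockSet (g '' B) :=
  hB.image g.toGraphIso

/-- An automorphism maps the graph induced on a set isomorphically onto the graph induced on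
the image of the set. -/
def Aut.induceIso (g : Γ.Aut) {s t : Set V} (h : g '' s = t) :
    (Γ.induce s).Adj ≃r (Γ.induce t).Adj where
  toEquiv := g.toEquiv.subtypeEquiv fun a => by
    rw [← h]; exact (g.injective.mem_set_image).symm
  map_rel_iff' := g.map_rel_iff

theorem gate_image {B : Set V} [Nontrivial V] (hG : Γ.toSimpleGraphInclusive.Connected)
    (hB : Γ.toSimpleGraphInclusive.IsBlockSet B) (g : Γ.Aut) (v : V) :
    Γ.toSimpleGraphInclusive.gate (g '' B) (g v) = g (Γ.toSimpleGraphInclusive.gate B v) :=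
  hB.gate_image hG g.toGraphIso v

theorem HasConnectivityOne.nontrivial (h : Γ.HasConnectivityOne) : Nontrivial V := by
  obtain ⟨-, a, ha⟩ := h
  by_contra hV
  rw [not_nontrivial_iff_subsingleton] at hV
  exact ha fun x => absurd (Subsingleton.elim _ _) x.2

theorem HasConnectivityOne.connected (h : Γ.HasConnectivityOne) :
    Γ.toSimpleGraphInclusive.Connected :=
  have := h.nontrivial
  ⟨h.1⟩

/-- In a vertex-transitive graph with connectivity one, every vertex is a cut vertex, and so
lies in two blocks. -/
theorem HasConnectivityOne.exists_ne_isBlockSet (h : Γ.HasConnectivityOne)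
    (htrans : Γ.IsVertexTransitive) (x : V) :
    ∃ B₁ B₂, Γ.toSimpleGraphInclusive.IsBlockSet B₁ ∧ Γ.toSimpleGraphInclusive.IsBlockSet B₂ ∧
      B₁ ≠ B₂ ∧ x ∈ B₁ ∧ x ∈ B₂ := by
  have := h.nontrivial
  obtain ⟨a, ha⟩ := h.2
  rw [isConn_induce_iff] at ha
  obtain ⟨B₁, B₂, h₁, h₂, hne, ha₁, ha₂⟩ :=
    SimpleGraph.exists_ne_isBlockSet_of_not_preconnected h.connected ha
  obtain ⟨g, rfl⟩ := htrans.exists_smul_eq a x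
  exact ⟨g '' B₁, g '' B₂, isBlockSet_image h₁ g, isBlockSet_image h₂ g,
    fun h' => hne (g.injective.image_injective h'), ⟨a, ha₁, rfl⟩, ⟨a, ha₂, rfl⟩⟩

end Digraph

/-! ### Primitivity and invariant equivalence relations -/

namespace Digraph

variable {V : Type*} {Γ : Digraph V}

/-- An equivalence relation preserved by a primitive group is trivial or universal, since its
classes are sets of imprimitivity. -/
theorem IsPrimitive.eq_or_forall (h : Γ.IsPrimitive) (r : Setoid V)
    (hr : ∀ (g : Γ.Aut) x y, r x y → r (g x) (g y)) : (∀ x y, r x y → x = y) ∨ ∀ x y, r x y := by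
  have hr' : ∀ (g : Γ.Aut) x y, r (g x) (g y) → r x y := fun g x y hxy => by
    simpa using hr g⁻¹ _ _ hxy
  have hclass : ∀ x, MulAction.IsBlock Γ.Aut {y | r x y} := by
    intro x
    rw [MulAction.isBlock_iff_smul_eq_of_nonempty]
    rintro g ⟨_, ⟨y, hy, rfl⟩, hy'⟩
    have hgx : r x (g x) := r.trans hy' (r.symm (hr g _ _ hy))
    ext z
    rw [Set.mem_smul_set_iff_inv_smul_mem]
    constructor
    · intro hz
      have := hr g _ _ hz
      simp only [RelIso.smul_def, RelIso.apply_inv_self] at this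
      exact r.trans hgx this
    · intro hz
      refine hr' g _ _ ?_
      simp only [RelIso.smul_def, RelIso.apply_inv_self]
      exact r.trans (r.symm hgx) hz
  by_cases hu : ∃ x, {y | r x y} = Set.univ
  · obtain ⟨x, hx⟩ := hu
    have hx' : ∀ y, r x y := fun y => (hx.symm ▸ Set.mem_univ y : y ∈ {y | r x y})
    exact .inr fun y z => r.trans (r.symm (hx' y)) (hx' z)
  · push Not at hu
    refine .inl fun x y hxy => ?_
    rcases h.isTrivialBlock_of_isBlock (hclass x) with hs | hs
    · exact hs (r.refl x) hxy
    · exact absurd hs (hu x)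

/-- Having no invariant equivalence relations other than the trivial and the universal one implies
having no nontrivial sets of imprimitivity: two vertices are related if the same translates of a
given set of imprimitivity contain them. -/
theorem isTrivialBlock_of_forall_setoid
    (h : ∀ r : Setoid V, (∀ (g : Γ.Aut) x y, r x y → r (g x) (g y)) →
      (∀ x y, r x y → x = y) ∨ ∀ x y, r x y)
    {X : Set V} (hX : MulAction.IsBlock Γ.Aut X) : MulAction.IsTrivialBlock X := by
  let r : Setoid V :=
    { r := fun y z => ∀ g : Γ.Aut, g y ∈ X ↔ g z ∈ X
      iseqv := ⟨fun _ _ => Iff.rfl, fun h g => (h g).symm, fun h h' g => (h g).trans (h' g)⟩ }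
  have hX' : ∀ y ∈ X, ∀ z ∈ X, r y z := by
    have key : ∀ (g : Γ.Aut), ∀ y ∈ X, ∀ z ∈ X, g y ∈ X → g z ∈ X := by
      intro g y hy z hz hgy
      rw [← MulAction.isBlock_iff_smul_eq_of_nonempty.1 hX (g := g) ⟨g y, ⟨y, hy, rfl⟩, hgy⟩]
      exact ⟨z, hz, rfl⟩
    exact fun y hy z hz g => ⟨key g y hy z hz, key g z hz y hy⟩
  rcases h r (fun g y z hyz k => hyz (k * g)) with h | h
  · exact .inl fun y hy z hz => h y z (hX' y hy z hz)
  · rcases X.eq_empty_or_nonempty with rfl | ⟨y, hy⟩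
    · exact .inl Set.subsingleton_empty
    · exact .inr (Set.eq_univ_of_forall fun z => (h y z 1).1 hy)

/-- On at least three vertices, transitivity need not be required separately: a group without
nontrivial invariant equivalence relations that fixes every vertex acts on at most two. -/
theorem isPrimitive_of_forall_setoid
    (h : ∀ r : Setoid V, (∀ (g : Γ.Aut) x y, r x y → r (g x) (g y)) →
      (∀ x y, r x y → x = y) ∨ ∀ x y, r x y)
    {a b c : V} (hab : a ≠ b) (hac : a ≠ c) (hbc : b ≠ c) : Γ.IsPrimitive := by
  refine MulAction.IsPreprimitive.mk' (fun hfix => ?_) (isTrivialBlock_of_forall_setoid h)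
  have hfix' : ∀ (g : Γ.Aut) x, g x = x := fun g x =>
    (hfix.symm ▸ trivial : x ∈ MulAction.fixedPoints Γ.Aut V) g
  -- The partition into `{c}` and its complement would be invariant.
  rcases h (Setoid.comap (fun x => x = c) ⊥) (fun g x y hxy => by
    rwa [hfix', hfix']) with h | h
  · exact hab (h a b (show (a = c) = (b = c) by simp [hac, hbc]))
  · have : (a = c) = (c = c) := h a c
    exact hac (this.mpr rfl)

/-! ### Blocks of a primitive graph -/

section Gate

variable {B B₁ B₂ : Set V} (hconn : Γ.HasConnectivityOne)

/-- Two vertices are related if, under every automorphism, the gates of their images in the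
block `B` are related by `r`. -/
noncomputable def gateSetoid (hconn : Γ.HasConnectivityOne)
    (hB : Γ.toSimpleGraphInclusive.IsBlockSet B) (r : Setoid B) : Setoid V where
  r u w := have := hconn.nontrivial; ∀ g : Γ.Aut,
    r ⟨_, hB.gate_mem hconn.connected (g u)⟩ ⟨_, hB.gate_mem hconn.connected (g w)⟩
  iseqv := ⟨fun _ _ => r.refl _, fun h g => r.symm (h g), fun h h' g => r.trans (h g) (h' g)⟩

include hconn

theorem gateSetoid_map (hB : Γ.toSimpleGraphInclusive.IsBlockSet B) (r : Setoid B) (g : Γ.Aut)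
    (x y : V) (h : gateSetoid hconn hB r x y) : gateSetoid hconn hB r (g x) (g y) :=
  fun k => h (k * g)

theorem gateSetoid_coe (hB : Γ.toSimpleGraphInclusive.IsBlockSet B) (r : Setoid B) {x y : B}
    (h : gateSetoid hconn hB r x y) : r x y := by
  have := hconn.nontrivial
  have := h 1
  simp only [RelIso.coe_one, id_eq, hB.gate_of_mem hconn.connected x.2,
    hB.gate_of_mem hconn.connected y.2] at this
  exact this

/-- If no automorphism maps `B₂` to `B₁`, all images of two vertices of `B₂` have the same gate
in `B₁`. Hence in a primitive graph the blocks form a single orbit. -/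
theorem IsPrimitive.exists_image_eq (hprim : Γ.IsPrimitive)
    (h₁ : Γ.toSimpleGraphInclusive.IsBlockSet B₁) (h₂ : Γ.toSimpleGraphInclusive.IsBlockSet B₂) :
    ∃ g : Γ.Aut, g '' B₁ = B₂ := by
  have := hconn.nontrivial
  by_contra! hne
  rcases hprim.eq_or_forall (gateSetoid hconn h₁ ⊥) (gateSetoid_map hconn h₁ ⊥) with h | h
  · obtain ⟨x, hx, y, hy, hxy⟩ := h₂.nontrivial hconn.connected
    refine hxy (h x y fun g => Subtype.ext ?_)
    refine h₁.gate_eq_of_ne hconn.connected (isBlockSet_image h₂ g) (fun h' => ?_)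
      ⟨x, hx, rfl⟩ ⟨y, hy, rfl⟩
    refine hne g⁻¹ ?_
    rw [h', Set.image_image]
    simp
  · obtain ⟨x, hx, y, hy, hxy⟩ := h₁.nontrivial hconn.connected
    have : (⟨x, hx⟩ : B₁) = ⟨y, hy⟩ := gateSetoid_coe hconn h₁ ⊥ (h x y)
    exact hxy (congrArg Subtype.val this)

/-- An invariant equivalence relation on a block is the trace of an invariant equivalence
relation on the whole graph. -/
theorem IsPrimitive.eq_or_forall_induce (hprim : Γ.IsPrimitive)
    (hB : Γ.toSimpleGraphInclusive.IsBlockSet B) (r : Setoid B)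
    (hr : ∀ (g : (Γ.induce B).Aut) x y, r x y → r (g x) (g y)) :
    (∀ x y, r x y → x = y) ∨ ∀ x y, r x y := by
  have := hconn.nontrivial
  rcases hprim.eq_or_forall (gateSetoid hconn hB r) (gateSetoid_map hconn hB r) with h | h
  · refine .inl fun x y hxy => Subtype.ext (h x y fun g => ?_)
    by_cases hg : g '' B = B
    · have := hr (g.induceIso hg) x y hxy
      have hx : g x ∈ B := hg.subset ⟨x, x.2, rfl⟩
      have hy : g y ∈ B := hg.subset ⟨y, y.2, rfl⟩
      simp only [hB.gate_of_mem hconn.connected hx, hB.gate_of_mem hconn.connected hy]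
      exact this
    · have := hB.gate_eq_of_ne hconn.connected (isBlockSet_image hB g) (Ne.symm hg)
        ⟨x, x.2, rfl⟩ ⟨y, y.2, rfl⟩
      simp only [this]
      exact r.refl _
  · exact .inr fun x y => gateSetoid_coe hconn hB r (h x y)

/-! ### Invariant cocycles -/

/-- Suppose the pairs of vertices of each block carry differences in an abelian group, compatibly
with automorphisms. Adding up the differences of the gates over all blocks gives differences
for any two vertices. Vertices with trivial difference then form an invariant equivalence
relation, which is not universal, and not trivial because every vertex lies in two blocks. -/
theorem not_isPrimitive_of_cocycle (htrans : Γ.IsVertexTransitive) {A : Type*} [CommGroup A]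
    (δ : Set V → V → V → A)
    (hmul : ∀ B, Γ.toSimpleGraphInclusive.IsBlockSet B → ∀ x ∈ B, ∀ y ∈ B, ∀ z ∈ B,
      δ B x y * δ B y z = δ B x z)
    (hone : ∀ B, Γ.toSimpleGraphInclusive.IsBlockSet B → ∀ x ∈ B, ∀ y ∈ B,
      δ B x y = 1 → x = y)
    (hsurj : ∀ B, Γ.toSimpleGraphInclusive.IsBlockSet B → ∀ x ∈ B, ∀ a, ∃ y ∈ B, δ B x y = a)
    (hinv : ∀ B, Γ.toSimpleGraphInclusive.IsBlockSet B → ∀ (g : Γ.Aut), ∀ x ∈ B, ∀ y ∈ B,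
      δ (g '' B) (g x) (g y) = δ B x y) : ¬ Γ.IsPrimitive := by
  intro hprim
  have := hconn.nontrivial
  have hG := hconn.connected
  set K := Γ.toSimpleGraphInclusive with hK
  have hself : ∀ B, K.IsBlockSet B → ∀ x ∈ B, δ B x x = 1 := fun B hB x hx => by
    simpa using hmul B hB x hx x hx x hx
  let d : V → V → {B // K.IsBlockSet B} → A := fun x y B => δ B (K.gate B x) (K.gate B y)
  have hfin : ∀ x y, (Function.mulSupport (d x y)).Finite := by
    intro x y
    refine ((K.finite_gate_ne hG x y).preimage Subtype.val_injective.injOn).subset ?_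
    intro B hB
    refine ⟨B.2, fun h => hB ?_⟩
    simp only [d, h]
    exact hself B B.2 _ (B.2.gate_mem hG y)
  let D : V → V → A := fun x y => ∏ᶠ B, d x y B
  have hDmul : ∀ x y z, D x y * D y z = D x z := by
    intro x y z
    simp only [D]
    rw [← finprod_mul_distrib (hfin x y) (hfin y z)]
    refine finprod_congr fun B => ?_
    exact hmul B B.2 _ (B.2.gate_mem hG x) _ (B.2.gate_mem hG y) _ (B.2.gate_mem hG z)
  have hDself : ∀ x, D x x = 1 := fun x => by simpa using hDmul x x x
  have hDinv : ∀ (g : Γ.Aut) x y, D (g x) (g y) = D x y := by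
    intro g x y
    refine (finprod_eq_of_bijective (fun B => ⟨g '' B, isBlockSet_image B.2 g⟩) ⟨?_, ?_⟩ ?_).symm
    · intro B B' h
      exact Subtype.ext (g.injective.image_injective (congrArg Subtype.val h))
    · intro B
      refine ⟨⟨(g⁻¹ : Γ.Aut) '' B, isBlockSet_image B.2 g⁻¹⟩, Subtype.ext ?_⟩
      simp [Set.image_image]
    · intro B
      simp only [d, hK, gate_image hG B.2]
      exact (hinv B B.2 g _ (B.2.gate_mem hG x) _ (B.2.gate_mem hG y)).symm
  -- Two vertices of `B` have the same gate in every other block, so that only `B` contributes.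
  have hDB : ∀ B, K.IsBlockSet B → ∀ x ∈ B, ∀ y ∈ B, D x y = δ B x y := by
    intro B hB x hx y hy
    simp only [D]
    rw [finprod_eq_single _ (⟨B, hB⟩ : {B // K.IsBlockSet B})]
    · simp only [d, hB.gate_of_mem hG hx, hB.gate_of_mem hG hy]
    · intro B' hne
      simp only [d, B'.2.gate_eq_of_ne hG hB (fun h => hne (Subtype.ext h)) hx hy]
      exact hself B' B'.2 _ (B'.2.gate_mem hG y)
  obtain ⟨a⟩ := hG.nonempty
  obtain ⟨B₁, B₂, h₁, h₂, hne, ha₁, ha₂⟩ := hconn.exists_ne_isBlockSet htrans a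
  obtain ⟨b, hb, hba⟩ := (h₁.nontrivial hG).exists_ne a
  -- Taking the same step from `a` in two different blocks gives two vertices without difference.
  obtain ⟨c, hc, hac⟩ := hsurj B₂ h₂ a ha₂ (δ B₁ a b)
  let r : Setoid V :=
    { r := fun x y => D x y = 1
      iseqv := ⟨hDself, fun {x y} h => by have := hDmul x y x; rwa [h, hDself, one_mul] at this,
        fun {x y z} h h' => by have := hDmul x y z; rw [h, h', one_mul] at this; exact this.symm⟩ }
  rcases hprim.eq_or_forall r (fun g x y h => (hDinv g x y).trans h) with h | h
  · have hbc : D b c = 1 := by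
      have h1 := hDmul a b c
      rwa [hDB B₁ h₁ a ha₁ b hb, hDB B₂ h₂ a ha₂ c hc, hac, mul_eq_left] at h1
    have hbc' : b = c := h b c hbc
    exact hne (h₁.eq_of_mem h₂ hba hb ha₁ (hbc' ▸ hc) ha₂)
  · have h1 : D a b = 1 := h a b
    rw [hDB B₁ h₁ a ha₁ b hb] at h1
    exact hba (hone B₁ h₁ a ha₁ b hb h1).symm

/-- If the blocks had two vertices, the graph would be a tree, hence bipartite: the difference of
two vertices of a block, with values in `ℤ/2`, is nontrivial when they are distinct. -/
theorem IsPrimitive.three_le_encard (htrans : Γ.IsVertexTransitive) (hprim : Γ.IsPrimitive)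
    (hB : Γ.toSimpleGraphInclusive.IsBlockSet B) : 3 ≤ B.encard := by
  classical
  have := hconn.nontrivial
  by_contra hlt
  have hle : ∀ B', Γ.toSimpleGraphInclusive.IsBlockSet B' → ∀ x ∈ B', ∀ y ∈ B', ∀ z ∈ B',
      x ≠ y → y ≠ z → x = z := by
    intro B' hB' x hx y hy z hz hxy hyz
    by_contra hxz
    obtain ⟨g, rfl⟩ := hprim.exists_image_eq hconn hB hB'
    apply hlt
    rw [← g.injective.encard_image B, ← Set.encard_eq_three.2 ⟨x, y, z, hxy, hxz, hyz, rfl⟩]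
    apply Set.encard_le_encard
    rintro _ (rfl | rfl | rfl) <;> assumption
  let t : Multiplicative (ZMod 2) := Multiplicative.ofAdd 1
  have ht : t ≠ 1 := by decide
  have htt : t * t = 1 := by decide
  refine not_isPrimitive_of_cocycle hconn htrans (fun _ x y => if x = y then 1 else t)
    ?_ ?_ ?_ ?_ hprim
  · intro B' hB' x hx y hy z hz
    by_cases hxy : x = y
    · simp [hxy]
    · by_cases hyz : y = z
      · simp [hyz]
      · obtain rfl := hle B' hB' x hx y hy z hz hxy hyz
        simp [hxy, hyz, htt]
  · intro B' _ x _ y _ h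
    by_contra hxy
    exact ht (by simpa [hxy] using h)
  · intro B' hB' x hx a
    obtain ⟨y, hy, hyx⟩ := (hB'.nontrivial hconn.connected).exists_ne x
    have ha : a = 1 ∨ a = t := by revert a; decide
    rcases ha with rfl | rfl
    · exact ⟨x, hx, by simp⟩
    · exact ⟨y, hy, by simp [hyx.symm]⟩
  · intro B' _ g x _ y _
    simp

omit hconn in
/-- A primitive regular group is abelian: the trivial subgroup is maximal in it, so any element
other than the identity generates it. -/
theorem IsAutRegular.mul_comm [Nontrivial V] (hprim : Γ.IsPrimitive) (hreg : Γ.IsAutRegular)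
    (g h : Γ.Aut) : g * h = h * g := by
  obtain ⟨a⟩ := (inferInstance : Nonempty V)
  have hco : IsCoatom (⊥ : Subgroup Γ.Aut) := by
    have : MulAction.IsPreprimitive Γ.Aut V := hprim
    rw [← hreg.2 a]
    exact MulAction.IsPreprimitive.isCoatom_stabilizer_of_isPreprimitive _ a
  by_cases hg : g = 1
  · simp [hg]
  · have htop : Subgroup.zpowers g = ⊤ := hco.2 _ (bot_lt_iff_ne_bot.2 (by simpa using hg))
    obtain ⟨n, rfl⟩ := Subgroup.mem_zpowers_iff.1 (htop ▸ Subgroup.mem_top h)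
    exact (Commute.refl g).zpow_right n

/-- If the blocks had regular automorphism groups, then, all blocks being isomorphic to one block
`B` and its group being abelian, the elements of this group would be invariant differences. -/
theorem IsPrimitive.not_isAutRegular (htrans : Γ.IsVertexTransitive) (hprim : Γ.IsPrimitive)
    (hB : Γ.toSimpleGraphInclusive.IsBlockSet B) (hBprim : (Γ.induce B).IsPrimitive) :
    ¬ (Γ.induce B).IsAutRegular := by
  classical
  intro hreg
  have := hconn.nontrivial
  have : Nontrivial B := (hB.nontrivial hconn.connected).coe_sort
  have hiso : ∀ B', Γ.toSimpleGraphInclusive.IsBlockSet B' →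
      Nonempty ((Γ.induce B').Adj ≃r (Γ.induce B).Adj) := fun B' hB' => by
    obtain ⟨g, hg⟩ := hprim.exists_image_eq hconn hB' hB
    exact ⟨g.induceIso hg⟩
  let θ : ∀ B', Γ.toSimpleGraphInclusive.IsBlockSet B' →
      (Γ.induce B').Adj ≃r (Γ.induce B).Adj := fun B' hB' => (hiso B' hB').some
  have hcomm := hreg.mul_comm hBprim
  let _ : CommGroup (Γ.induce B).Aut :=
    { (inferInstance : Group (Γ.induce B).Aut) with mul_comm := hcomm }
  have hfree : ∀ (a b : (Γ.induce B).Aut) (p : B), a p = b p → a = b := by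
    intro a b p h
    have hmem : b⁻¹ * a ∈ MulAction.stabilizer (Γ.induce B).Aut p := by
      rw [MulAction.mem_stabilizer_iff, RelIso.smul_def, RelIso.mul_apply, h,
        RelIso.inv_apply_self]
    rw [hreg.2 p, Subgroup.mem_bot, inv_mul_eq_one] at hmem
    exact hmem.symm
  -- The difference of `x` and `y` in a block is the group element moving `x` to `y`.
  have hex : ∀ (B' : Set V) (x y : V), ∃ a : (Γ.induce B).Aut,
      ∀ (hB' : Γ.toSimpleGraphInclusive.IsBlockSet B') (hx : x ∈ B') (hy : y ∈ B'),
        a (θ B' hB' ⟨x, hx⟩) = θ B' hB' ⟨y, hy⟩ := by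
    intro B' x y
    by_cases h : Γ.toSimpleGraphInclusive.IsBlockSet B' ∧ x ∈ B' ∧ y ∈ B'
    · obtain ⟨hB', hx, hy⟩ := h
      obtain ⟨a, ha⟩ := hreg.1.exists_smul_eq (θ B' hB' ⟨x, hx⟩) (θ B' hB' ⟨y, hy⟩)
      exact ⟨a, fun _ _ _ => ha⟩
    · exact ⟨1, fun hB' hx hy => absurd ⟨hB', hx, hy⟩ h⟩
  choose δ hδ using hex
  refine not_isPrimitive_of_cocycle hconn htrans δ ?_ ?_ ?_ ?_ hprim
  · intro B' hB' x hx y hy z hz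
    apply hfree _ _ (θ B' hB' ⟨x, hx⟩)
    rw [_root_.mul_comm]
    change δ B' y z (δ B' x y _) = _
    rw [hδ B' x y hB' hx hy, hδ B' y z hB' hy hz, hδ B' x z hB' hx hz]
  · intro B' hB' x hx y hy h
    have := hδ B' x y hB' hx hy
    rw [h, RelIso.coe_one, id_eq] at this
    exact congrArg Subtype.val ((θ B' hB').injective this)
  · intro B' hB' x hx a
    refine ⟨(θ B' hB').symm (a (θ B' hB' ⟨x, hx⟩)), Subtype.coe_prop _, ?_⟩
    apply hfree _ _ (θ B' hB' ⟨x, hx⟩)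
    rw [hδ B' x _ hB' hx (Subtype.coe_prop _), Subtype.coe_eta, RelIso.apply_symm_apply]
  · intro B' hB' g x hx y hy
    have hgB := isBlockSet_image hB' g
    have hgx : g x ∈ g '' B' := ⟨x, hx, rfl⟩
    have hgy : g y ∈ g '' B' := ⟨y, hy, rfl⟩
    apply hfree _ _ (θ _ hgB ⟨g x, hgx⟩)
    rw [hδ _ _ _ hgB hgx hgy]
    -- Compared through the identifications with `B`, the automorphism `g` becomes an element
    -- of the abelian group, and so commutes with the difference.
    let k : (Γ.induce B).Aut :=
      (θ B' hB').symm.trans ((g.induceIso rfl).trans (θ (g '' B') hgB))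
    have hk : ∀ v (hv : v ∈ B'),
        k (θ B' hB' ⟨v, hv⟩) = θ (g '' B') hgB ⟨g v, ⟨v, hv, rfl⟩⟩ := by
      intro v hv
      simp only [k, RelIso.trans_apply, RelIso.symm_apply_apply]
      rfl
    rw [← hk x hx, ← hk y hy, ← hδ B' x y hB' hx hy, ← RelIso.mul_apply, ← RelIso.mul_apply,
      hcomm]

/-- The blocks of a primitive graph are primitive. -/
theorem IsPrimitive.isPrimitive_induce (htrans : Γ.IsVertexTransitive) (hprim : Γ.IsPrimitive)
    (hB : Γ.toSimpleGraphInclusive.IsBlockSet B) : (Γ.induce B).IsPrimitive := by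
  obtain ⟨t, ht, h3⟩ := Set.exists_subset_encard_eq (hprim.three_le_encard hconn htrans hB)
  obtain ⟨a, b, c, hab, hac, hbc, rfl⟩ := Set.encard_eq_three.1 h3
  refine isPrimitive_of_forall_setoid (hprim.eq_or_forall_induce hconn hB)
    (a := ⟨a, ht (by simp)⟩) (b := ⟨b, ht (by simp)⟩) (c := ⟨c, ht (by simp)⟩) ?_ ?_ ?_ <;>
  simpa

end Gate

end Digraph

/-! ### Extending isomorphisms between blocks -/

namespace Digraph

variable {V : Type*} {Γ : Digraph V} {B C B₁ B₂ : Set V}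

/-- The map `t` restricts to an isomorphism from the graph induced on `B` to the graph induced
on `C`. -/
def IsIsoOn (Γ : Digraph V) (t : V → V) (B C : Set V) : Prop :=
  Set.BijOn t B C ∧ ∀ x ∈ B, ∀ y ∈ B, Γ.Adj (t x) (t y) ↔ Γ.Adj x y

theorem exists_isIsoOn (θ : (Γ.induce B).Adj ≃r (Γ.induce C).Adj) :
    ∃ t, Γ.IsIsoOn t B C ∧ ∀ x : B, t x = θ x := by
  classical
  refine ⟨fun v => if h : v ∈ B then θ ⟨v, h⟩ else v, ⟨⟨?_, ?_, ?_⟩, ?_⟩, fun x => by simp⟩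
  · intro x hx
    simp [hx]
  · intro x hx y hy h
    simp only [hx, hy, dite_true] at h
    exact congrArg Subtype.val (θ.injective (Subtype.ext h))
  · intro y hy
    exact ⟨θ.symm ⟨y, hy⟩, Subtype.coe_prop _, by simp⟩
  · intro x hx y hy
    simp only [hx, hy, dite_true]
    exact θ.map_rel_iff (a := ⟨x, hx⟩) (b := ⟨y, hy⟩)

/-- A map of the vertices that maps blocks isomorphically onto blocks, and the blocks at each
vertex bijectively onto the blocks at its image, is an automorphism. It is injective because,
seen from a vertex `r`, the block leading from `v` towards `r` is mapped to the block leading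
from the image of `v` towards the image of `r`. -/
theorem exists_aut_of_isIsoOn (hloopless : ∀ v, ¬ Γ.Adj v v) (hconn : Γ.HasConnectivityOne)
    (f : V → V) (F : Set V → Set V)
    (hF : ∀ B, Γ.toSimpleGraphInclusive.IsBlockSet B → Γ.toSimpleGraphInclusive.IsBlockSet (F B))
    (hinj : ∀ B B', Γ.toSimpleGraphInclusive.IsBlockSet B →
      Γ.toSimpleGraphInclusive.IsBlockSet B' → ∀ v, v ∈ B → v ∈ B' → F B = F B' → B = B')
    (hsurj : ∀ v C, Γ.toSimpleGraphInclusive.IsBlockSet C → f v ∈ C →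
      ∃ B, Γ.toSimpleGraphInclusive.IsBlockSet B ∧ v ∈ B ∧ F B = C)
    (hiso : ∀ B, Γ.toSimpleGraphInclusive.IsBlockSet B → Γ.IsIsoOn f B (F B)) :
    ∃ g : Γ.Aut, ∀ v, g v = f v := by
  have := hconn.nontrivial
  have hG := hconn.connected
  set K := Γ.toSimpleGraphInclusive with hK
  have hKadj : ∀ x y, Γ.Adj x y → K.Adj x y := fun x y h =>
    ⟨fun h' => hloopless y (by rwa [h'] at h), .inl h⟩
  have key : ∀ r n v B, K.dist r v = n → v ≠ r → K.IsBlockSet B → v ∈ B → K.gate B r ≠ v →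
      K.gate (F B) (f r) = f (K.gate B r) := by
    intro r n
    induction n using Nat.strong_induction_on with
    | _ n ih =>
      intro v B hn hv hB hvB hne
      have hqB := hB.gate_mem hG r
      have hlt := hB.dist_gate_lt hG hvB hne
      set q := K.gate B r
      by_cases hqr : q = r
      · rw [hqr]
        exact (hF B hB).gate_of_mem hG ((hiso B hB).1.mapsTo (hqr ▸ hqB))
      · obtain ⟨B', ⟨hB', hqB', hne'⟩, -⟩ := K.existsUnique_gate_ne hG r hqr
        have h1 := ih _ (hn ▸ hlt) q B' rfl hqr hB' hqB' hne'
        have h2 : f (K.gate B' r) ≠ f q := fun h =>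
          hne' ((hiso B' hB').1.injOn (hB'.gate_mem hG r) hqB' h)
        have hfq : f q ∈ F B' := (hiso B' hB').1.mapsTo hqB'
        have hfr : f q ≠ f r := by
          intro h
          rw [← h, (hF B' hB').gate_of_mem hG hfq] at h1
          exact h2 h1.symm
        -- At `f q` only the block `F B'` leads towards `f r`, and `F B` is another block.
        by_contra h3
        have hFF := (K.existsUnique_gate_ne hG (f r) hfr).unique
          ⟨hF B hB, (hiso B hB).1.mapsTo hqB, h3⟩ ⟨hF B' hB', hfq, by rwa [h1]⟩
        exact hne' (by rw [← hinj B B' hB hB' q hqB hqB' hFF])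
  have hfinj : Function.Injective f := by
    intro v r h
    by_contra hv
    obtain ⟨B, ⟨hB, hvB, hne⟩, -⟩ := K.existsUnique_gate_ne hG r hv
    have h1 := key r _ v B rfl hv hB hvB hne
    rw [← h, (hF B hB).gate_of_mem hG ((hiso B hB).1.mapsTo hvB)] at h1
    exact hne ((hiso B hB).1.injOn (hB.gate_mem hG r) hvB h1.symm)
  have hstep : ∀ v w, K.Adj (f v) w →
      ∃ B, K.IsBlockSet B ∧ v ∈ B ∧ ∃ u ∈ B, f u = w := by
    intro v w h
    obtain ⟨C, hC, hvC, hwC⟩ := SimpleGraph.exists_isBlockSet_of_adj h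
    obtain ⟨B, hB, hvB, rfl⟩ := hsurj v C hC hvC
    obtain ⟨u, hu, rfl⟩ := (hiso B hB).1.surjOn hwC
    exact ⟨B, hB, hvB, u, hu, rfl⟩
  have hfsurj : Function.Surjective f := by
    obtain ⟨a⟩ := hG.nonempty
    intro w
    refine ((K.preconnected_iff_forall_prop.1 hG.preconnected) (fun v => v ∈ Set.range f)
      (fun x y hxy => ?_) (f a) w).1 ⟨a, rfl⟩
    have hr : ∀ x y, K.Adj x y → x ∈ Set.range f → y ∈ Set.range f := by
      rintro _ y hxy ⟨v, rfl⟩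
      obtain ⟨-, -, -, u, -, hu⟩ := hstep v y hxy
      exact ⟨u, hu⟩
    exact ⟨hr x y hxy, hr y x hxy.symm⟩
  refine ⟨⟨Equiv.ofBijective f ⟨hfinj, hfsurj⟩, fun {x y} => ?_⟩, fun _ => rfl⟩
  change Γ.Adj (f x) (f y) ↔ Γ.Adj x y
  constructor
  · intro h
    obtain ⟨B, hB, hxB, u, hu, huy⟩ := hstep x (f y) (hKadj _ _ h)
    obtain rfl := hfinj huy
    exact ((hiso B hB).2 x hxB u hu).1 h
  · intro h
    obtain ⟨B, hB, hxB, hyB⟩ := SimpleGraph.exists_isBlockSet_of_adj (hKadj _ _ h)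
    exact ((hiso B hB).2 x hxB y hyB).2 h

/-- Any block at `v` can be matched with any block at `w` by a bijection from the blocks at `v`
to the blocks at `w`: transport by an automorphism taking `v` to `w`, then swap two blocks. -/
theorem exists_bijOn_blocks (htrans : Γ.IsVertexTransitive) {v w : V} {P Q : Set V}
    (hP : Γ.toSimpleGraphInclusive.IsBlockSet P) (hQ : Γ.toSimpleGraphInclusive.IsBlockSet Q)
    (hv : v ∈ P) (hw : w ∈ Q) :
    ∃ s : Set V → Set V, Set.BijOn s {B | Γ.toSimpleGraphInclusive.IsBlockSet B ∧ v ∈ B}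
      {B | Γ.toSimpleGraphInclusive.IsBlockSet B ∧ w ∈ B} ∧ s P = Q := by
  classical
  obtain ⟨g, rfl⟩ := htrans.exists_smul_eq v w
  have hgP : Γ.toSimpleGraphInclusive.IsBlockSet (g '' P) ∧ g • v ∈ g '' P :=
    ⟨isBlockSet_image hP g, v, hv, rfl⟩
  have hswap : ∀ C, Γ.toSimpleGraphInclusive.IsBlockSet C ∧ g • v ∈ C →
      Γ.toSimpleGraphInclusive.IsBlockSet (Equiv.swap (g '' P) Q C) ∧
        g • v ∈ Equiv.swap (g '' P) Q C := by
    intro C hC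
    rw [Equiv.swap_apply_def]
    split_ifs
    · exact ⟨hQ, hw⟩
    · exact hgP
    · exact hC
  refine ⟨fun B => Equiv.swap (g '' P) Q (g '' B), ⟨?_, ?_, ?_⟩, by simp⟩
  · rintro B ⟨hB, hvB⟩
    exact hswap _ ⟨isBlockSet_image hB g, v, hvB, rfl⟩
  · intro B _ B' _ h
    exact g.injective.image_injective ((Equiv.swap _ _).injective h)
  · intro C hC
    obtain ⟨h1, h2⟩ := hswap C hC
    refine ⟨(g⁻¹ : Γ.Aut) '' Equiv.swap (g '' P) Q C,
      ⟨isBlockSet_image h1 g⁻¹, _, h2, by simp⟩, ?_⟩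
    simp [Set.image_image]

/-- If all blocks are isomorphic and vertex-transitive, every isomorphism `θ` between two blocks
extends to an automorphism of the whole graph. The extension is built by recursion on the distance
from a vertex `r` of the first block: a block with gate `q` is mapped to a block at the image of
`q` by an isomorphism respecting these two vertices, and the blocks at each vertex are matched
with the blocks at its image, the block leading back to `r` with its image. -/
theorem exists_aut_extending (hloopless : ∀ v, ¬ Γ.Adj v v) (hconn : Γ.HasConnectivityOne)
    (htrans : Γ.IsVertexTransitive)
    (hiso : ∀ B C, Γ.toSimpleGraphInclusive.IsBlockSet B → Γ.toSimpleGraphInclusive.IsBlockSet C →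
      Nonempty ((Γ.induce B).Adj ≃r (Γ.induce C).Adj))
    (hBtrans : ∀ B, Γ.toSimpleGraphInclusive.IsBlockSet B → (Γ.induce B).IsVertexTransitive)
    (h₁ : Γ.toSimpleGraphInclusive.IsBlockSet B₁) (h₂ : Γ.toSimpleGraphInclusive.IsBlockSet B₂)
    (θ : (Γ.induce B₁).Adj ≃r (Γ.induce B₂).Adj) : ∃ g : Γ.Aut, ∀ x : B₁, g x = θ x := by
  classical
  have := hconn.nontrivial
  have hG := hconn.connected
  set K := Γ.toSimpleGraphInclusive with hK
  obtain ⟨r, hr⟩ := (h₁.nontrivial hG).nonempty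
  obtain ⟨t₀, ht₀, ht₀θ⟩ := exists_isIsoOn θ
  -- The block `P v` at `v` leads towards `r`; at `r` itself it is the given block `B₁`.
  have hP : ∀ v, ∃ P, K.IsBlockSet P ∧ v ∈ P ∧ (v = r → P = B₁) ∧ (v ≠ r → K.gate P r ≠ v) := by
    intro v
    by_cases hv : v = r
    · exact ⟨B₁, h₁, hv ▸ hr, fun _ => rfl, fun h => absurd hv h⟩
    · obtain ⟨P, ⟨hP, hvP, hne⟩, -⟩ := K.existsUnique_gate_ne hG r hv
      exact ⟨P, hP, hvP, fun h => absurd h hv, fun _ => hne⟩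
  choose P hPblock hmemP hPr hPgate using hP
  -- Isomorphisms between blocks with a marked vertex; the one extending `θ` at `r` is prescribed.
  have hτ : ∀ B C q q', ∃ t : V → V, (K.IsBlockSet B → K.IsBlockSet C → q ∈ B → q' ∈ C →
      Γ.IsIsoOn t B C ∧ t q = q') ∧ (B = B₁ → C = B₂ → q = r → q' = t₀ r → t = t₀) := by
    intro B C q q'
    by_cases hspec : B = B₁ ∧ C = B₂ ∧ q = r ∧ q' = t₀ r
    · obtain ⟨rfl, rfl, rfl, rfl⟩ := hspec
      exact ⟨t₀, fun _ _ _ _ => ⟨ht₀, rfl⟩, fun _ _ _ _ => rfl⟩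
    by_cases h : K.IsBlockSet B ∧ K.IsBlockSet C ∧ q ∈ B ∧ q' ∈ C
    · obtain ⟨hB, hC, hq, hq'⟩ := h
      obtain ⟨φ⟩ := hiso B C hB hC
      obtain ⟨ψ, hψ⟩ := (hBtrans C hC).exists_smul_eq (φ ⟨q, hq⟩) ⟨q', hq'⟩
      obtain ⟨t, ht, htφ⟩ := exists_isIsoOn (φ.trans ψ)
      refine ⟨t, fun _ _ _ _ => ⟨ht, ?_⟩, fun a b c d => absurd ⟨a, b, c, d⟩ hspec⟩
      exact (htφ ⟨q, hq⟩).trans (congrArg Subtype.val hψ)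
    · exact ⟨id, fun a b c d => absurd ⟨a, b, c, d⟩ h,
        fun a b c d => absurd ⟨a, b, c, d⟩ hspec⟩
  choose τ hτiso hτθ using hτ
  have hσ : ∀ v w P Q, ∃ s : Set V → Set V,
      K.IsBlockSet P → K.IsBlockSet Q → v ∈ P → w ∈ Q →
        Set.BijOn s {B | K.IsBlockSet B ∧ v ∈ B} {B | K.IsBlockSet B ∧ w ∈ B} ∧ s P = Q := by
    intro v w P Q
    by_cases h : K.IsBlockSet P ∧ K.IsBlockSet Q ∧ v ∈ P ∧ w ∈ Q
    · obtain ⟨hP, hQ, hv, hw⟩ := h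
      obtain ⟨s, hs⟩ := exists_bijOn_blocks htrans hP hQ hv hw
      exact ⟨s, fun _ _ _ _ => hs⟩
    · exact ⟨id, fun a b c d => absurd ⟨a, b, c, d⟩ h⟩
  choose σ hσbij using hσ
  -- The recursion computes the image of `v` together with the image of the block `P v`.
  obtain ⟨st, hst⟩ : ∃ st : V → V × Set V, ∀ v, st v =
      if v = r then (t₀ r, B₂) else
        let q := K.gate (P v) r
        let Q := σ q (st q).1 (P q) (st q).2 (P v)
        (τ (P v) Q q (st q).1 v, Q) := by
    have hwf : WellFounded (fun u v => K.dist r u < K.dist r v) :=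
      (measure fun v => K.dist r v).wf
    refine ⟨hwf.fix fun v ih => if h : v = r then (t₀ r, B₂) else
        let q := K.gate (P v) r
        let s := ih q ((hPblock v).dist_gate_lt hG (hmemP v) (hPgate v h))
        let Q := σ q s.1 (P q) s.2 (P v)
        (τ (P v) Q q s.1 v, Q), fun v => ?_⟩
    rw [hwf.fix_eq]
    split_ifs <;> rfl
  let f : V → V := fun v => (st v).1
  let Q : V → Set V := fun v => (st v).2
  let s : V → Set V → Set V := fun v => σ v (f v) (P v) (Q v)
  let F : Set V → Set V := fun B => s (K.gate B r) B
  have hfr : f r = t₀ r := by simp only [f]; rw [hst]; simp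
  have hQr : Q r = B₂ := by simp only [Q]; rw [hst]; simp
  have hQv : ∀ v, v ≠ r → Q v = F (P v) := by
    intro v hv
    simp only [Q]; rw [hst, if_neg hv]
  have hfv : ∀ v, v ≠ r →
      f v = τ (P v) (F (P v)) (K.gate (P v) r) (f (K.gate (P v) r)) v := by
    intro v hv
    simp only [f]; rw [hst, if_neg hv]
  have hQ : ∀ n v, K.dist r v = n → K.IsBlockSet (Q v) ∧ f v ∈ Q v := by
    intro n
    induction n using Nat.strong_induction_on with
    | _ n ih =>
      intro v hn
      by_cases hv : v = r
      · subst hv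
        rw [hQr, hfr]
        exact ⟨h₂, ht₀.1.mapsTo hr⟩
      · have hlt := (hPblock v).dist_gate_lt hG (hmemP v) (hPgate v hv)
        have hq := (hPblock v).gate_mem hG r
        obtain ⟨hQq, hfq⟩ := ih _ (hn ▸ hlt) _ rfl
        have hs := (hσbij _ _ _ _ (hPblock _) hQq (hmemP _) hfq).1.mapsTo ⟨hPblock v, hq⟩
        rw [hQv v hv, hfv v hv]
        refine ⟨hs.1, ?_⟩
        exact (hτiso _ _ _ _ (hPblock v) hs.1 hq hs.2).1.1.mapsTo (hmemP v)
  have hs : ∀ v, Set.BijOn (s v) {B | K.IsBlockSet B ∧ v ∈ B} {B | K.IsBlockSet B ∧ f v ∈ B} ∧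
      s v (P v) = Q v := fun v =>
    hσbij _ _ _ _ (hPblock v) (hQ _ v rfl).1 (hmemP v) (hQ _ v rfl).2
  have hPeq : ∀ B v, K.IsBlockSet B → v ∈ B → K.gate B r ≠ v → v ≠ r ∧ P v = B := by
    intro B v hB hv hne
    have hvr : v ≠ r := by
      rintro rfl
      exact hne (hB.gate_of_mem hG hv)
    exact ⟨hvr, (K.existsUnique_gate_ne hG r hvr).unique
      ⟨hPblock v, hmemP v, hPgate v hvr⟩ ⟨hB, hv, hne⟩⟩
  have hFs : ∀ B v, K.IsBlockSet B → v ∈ B → F B = s v B := by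
    intro B v hB hv
    by_cases hne : K.gate B r = v
    · simp only [F, hne]
    · obtain ⟨hvr, rfl⟩ := hPeq B v hB hv hne
      rw [(hs v).2, hQv v hvr]
  have hFmem : ∀ B v, K.IsBlockSet B → v ∈ B → K.IsBlockSet (F B) ∧ f v ∈ F B := by
    intro B v hB hv
    rw [hFs B v hB hv]
    exact (hs v).1.mapsTo ⟨hB, hv⟩
  have hτF : ∀ B, K.IsBlockSet B →
      Γ.IsIsoOn (τ B (F B) (K.gate B r) (f (K.gate B r))) B (F B) ∧
        Set.EqOn (τ B (F B) (K.gate B r) (f (K.gate B r))) f B := by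
    intro B hB
    have hq := hB.gate_mem hG r
    obtain ⟨hFB, hfq⟩ := hFmem B _ hB hq
    obtain ⟨h3, h4⟩ := hτiso _ _ _ _ hB hFB hq hfq
    refine ⟨h3, fun v hv => ?_⟩
    by_cases hne : K.gate B r = v
    · rw [← hne]
      exact h4
    · obtain ⟨hvr, rfl⟩ := hPeq B v hB hv hne
      exact (hfv v hvr).symm
  obtain ⟨g, hg⟩ := exists_aut_of_isIsoOn hloopless hconn f F
    (fun B hB => (hFmem B _ hB (hB.gate_mem hG r)).1)
    (fun B B' hB hB' v hv hv' h => by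
      rw [hFs B v hB hv, hFs B' v hB' hv'] at h
      exact (hs v).1.injOn ⟨hB, hv⟩ ⟨hB', hv'⟩ h)
    (fun v C hC hvC => by
      obtain ⟨B, ⟨hB, hv⟩, hBC⟩ := (hs v).1.surjOn ⟨hC, hvC⟩
      exact ⟨B, hB, hv, (hFs B v hB hv).trans hBC⟩)
    (fun B hB => by
      obtain ⟨h3, h4⟩ := hτF B hB
      refine ⟨h3.1.congr h4, fun x hx y hy => ?_⟩
      rw [← h4 hx, ← h4 hy]
      exact h3.2 x hx y hy)
  refine ⟨g, fun x => ?_⟩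
  have hgate := h₁.gate_of_mem hG hr
  have hFB₁ : F B₁ = B₂ := by rw [hFs B₁ r h₁ hr, ← hQr, ← (hs r).2, hPr r rfl]
  rw [hg, ← (hτF B₁ h₁).2 x.2, hFB₁, hgate, hτθ _ _ _ _ rfl rfl rfl hfr, ht₀θ]

/-- An automorphism preserving a block and fixing one of its vertices `a` may be replaced by
the identity on the part of the graph attached to the block at `a`. -/
theorem exists_aut_fixing_gate (hconn : Γ.HasConnectivityOne)
    (hB : Γ.toSimpleGraphInclusive.IsBlockSet B) (g : Γ.Aut) (hg : g '' B = B) {a : V}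
    (ha : g a = a) :
    ∃ g' : Γ.Aut, (∀ v, Γ.toSimpleGraphInclusive.gate B v = a → g' v = v) ∧
      ∀ v, Γ.toSimpleGraphInclusive.gate B v ≠ a → g' v = g v := by
  classical
  have := hconn.nontrivial
  have hG := hconn.connected
  set K := Γ.toSimpleGraphInclusive with hK
  have hgate : ∀ v, K.gate B (g v) = a ↔ K.gate B v = a := by
    intro v
    have := gate_image hG hB g v
    rw [hg] at this
    rw [← hK] at this
    rw [this]
    constructor
    · exact fun h => g.injective (h.trans ha.symm)
    · rintro h
      rw [h, ha]
  have hgate' : ∀ v, K.gate B (g.symm v) = a ↔ K.gate B v = a := by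
    intro v
    rw [← hgate, RelIso.apply_symm_apply]
  have hno : ∀ u w, K.gate B u = a → K.gate B w ≠ a → u ≠ a → ¬ K.Adj u w := by
    intro u w hu hw hua h
    refine hw ((hB.gate_eq_of_adj hG h fun h' => hua ?_).symm.trans hu)
    rw [← hu, hB.gate_of_mem hG h'.1]
  have hmix : ∀ u w, K.gate B u = a → K.gate B w ≠ a →
      (Γ.Adj u (g w) ↔ Γ.Adj u w) ∧ (Γ.Adj (g w) u ↔ Γ.Adj w u) := by
    intro u w hu hw
    by_cases hua : u = a
    · have hgu : g u = u := by rw [hua, ha]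
      constructor
      · conv_lhs => rw [← hgu]
        exact g.map_rel_iff
      · conv_lhs => rw [← hgu]
        exact g.map_rel_iff
    · have hadj : ∀ x, K.gate B x ≠ a → ¬ Γ.Adj u x ∧ ¬ Γ.Adj x u := by
        intro x hx
        have hux : u ≠ x := fun h => hx (h ▸ hu)
        exact ⟨fun h => hno u x hu hx hua ⟨hux, .inl h⟩,
          fun h => hno u x hu hx hua ⟨hux, .inr h⟩⟩
      have h1 := hadj w hw
      have h2 := hadj (g w) (fun h => hw ((hgate w).1 h))
      exact ⟨iff_of_false h2.1 h1.1, iff_of_false h2.2 h1.2⟩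
  let e : V ≃ V :=
    { toFun := fun v => if K.gate B v = a then v else g v
      invFun := fun v => if K.gate B v = a then v else g.symm v
      left_inv := fun v => by
        by_cases h : K.gate B v = a <;> simp [h, hgate]
      right_inv := fun v => by
        by_cases h : K.gate B v = a <;> simp [h, hgate'] }
  have he : ∀ v, e v = if K.gate B v = a then v else g v := fun _ => rfl
  refine ⟨⟨e, fun {x y} => ?_⟩, fun v hv => (he v).trans (if_pos hv),
    fun v hv => (he v).trans (if_neg hv)⟩
  rw [he, he]
  split_ifs with hx hy hy
  · rfl
  · exact (hmix x y hx hy).1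
  · exact (hmix y x hy hx).2
  · exact g.map_rel_iff

end Digraph

/-! ### Graphs with primitive blocks -/

namespace Digraph

variable {V : Type*} {Γ : Digraph V}

/-- Vertices with the same stabiliser form an invariant equivalence relation. As vertex stabilisers
are maximal subgroups, it would be universal if the stabiliser of `a` fixed another vertex `b`. -/
theorem IsPrimitive.exists_apply_ne (hprim : Γ.IsPrimitive) (hreg : ¬ Γ.IsAutRegular) {a b : V}
    (hab : a ≠ b) : ∃ h : Γ.Aut, h a = a ∧ h b ≠ b := by
  by_contra! hfix
  have : Nontrivial V := ⟨a, b, hab⟩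
  have : MulAction.IsPreprimitive Γ.Aut V := hprim
  have hco := MulAction.IsPreprimitive.isCoatom_stabilizer_of_isPreprimitive Γ.Aut (X := V)
  have hstab : MulAction.stabilizer Γ.Aut b = MulAction.stabilizer Γ.Aut a :=
    ((hco a).le_iff.1 fun h hh => hfix h hh).resolve_left (hco b).1
  have hiff : ∀ h : Γ.Aut, h a = a ↔ h b = b := fun h => by
    have := congrArg (h ∈ ·) hstab
    exact (iff_of_eq this).symm
  have hconj : ∀ (g k : Γ.Aut) x, k (g x) = g x ↔ (g⁻¹ * k * g) x = x := by
    intro g k x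
    rw [RelIso.mul_apply, RelIso.mul_apply]
    constructor
    · intro h
      rw [h, RelIso.inv_apply_self]
    · intro h
      conv_rhs => rw [← h]
      rw [RelIso.apply_inv_self]
  let r : Setoid V :=
    { r := fun y z => ∀ h : Γ.Aut, h y = y ↔ h z = z
      iseqv := ⟨fun _ _ => Iff.rfl, fun h g => (h g).symm, fun h h' g => (h g).trans (h' g)⟩ }
  rcases hprim.eq_or_forall r
    (fun g x y hxy k => (hconj g k x).trans ((hxy _).trans (hconj g k y).symm)) with h | h
  · exact hab (h a b hiff)
  · refine hreg ⟨hprim.toIsPretransitive, fun x => (Subgroup.eq_bot_iff_forall _).2 fun k hk => ?_⟩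
    exact RelIso.ext fun y => (h x y k).1 hk

/-- If the blocks are pairwise isomorphic, primitive and not regular, the graph is primitive. Let
`x` and `y` be related, and let `a` be the gate of `x` in the block at `y` leading to `x`. Some
automorphism of the block fixes `a` and moves `y`. Extended to fix everything attached at `a`,
including `x`, it shows that `y` is related to another vertex of its block. -/
theorem isPrimitive_of_blocks (hloopless : ∀ v, ¬ Γ.Adj v v) (hconn : Γ.HasConnectivityOne)
    (htrans : Γ.IsVertexTransitive)
    (hiso : ∀ B C, Γ.toSimpleGraphInclusive.IsBlockSet B → Γ.toSimpleGraphInclusive.IsBlockSet C →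
      Nonempty ((Γ.induce B).Adj ≃r (Γ.induce C).Adj))
    (hprim : ∀ B, Γ.toSimpleGraphInclusive.IsBlockSet B → (Γ.induce B).IsPrimitive)
    (hreg : ∀ B, Γ.toSimpleGraphInclusive.IsBlockSet B → ¬ (Γ.induce B).IsAutRegular) :
    Γ.IsPrimitive := by
  have := hconn.nontrivial
  have hG := hconn.connected
  have hext := fun B₁ B₂ => exists_aut_extending (B₁ := B₁) (B₂ := B₂) hloopless hconn htrans hiso
    fun B hB => (hprim B hB).toIsPretransitive
  refine { toIsPretransitive := htrans, isTrivialBlock_of_isBlock := fun {X} =>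
    isTrivialBlock_of_forall_setoid fun r hr => ?_ }
  by_contra! hcon
  obtain ⟨⟨x, y, hxy, hne⟩, u, v, huv⟩ := hcon
  obtain ⟨B, ⟨hB, hyB, hxB⟩, -⟩ :=
    Γ.toSimpleGraphInclusive.existsUnique_gate_ne hG x (Ne.symm hne)
  have haB := hB.gate_mem hG x
  set a := Γ.toSimpleGraphInclusive.gate B x with ha
  obtain ⟨h, hha, hhy⟩ := (hprim B hB).exists_apply_ne (hreg B hB) (a := ⟨a, haB⟩)
    (b := ⟨y, hyB⟩) (fun h => hxB (congrArg Subtype.val h))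
  obtain ⟨g, hg⟩ := hext B B hB hB h
  have hgB : g '' B = B := by
    ext z
    constructor
    · rintro ⟨w, hw, rfl⟩
      rw [hg ⟨w, hw⟩]
      exact Subtype.coe_prop _
    · intro hz
      refine ⟨h.symm ⟨z, hz⟩, Subtype.coe_prop _, ?_⟩
      rw [hg, RelIso.apply_symm_apply]
  obtain ⟨g', hg'₁, hg'₂⟩ := exists_aut_fixing_gate hconn hB g hgB
    ((hg ⟨a, haB⟩).trans (congrArg Subtype.val hha))
  have hyy : r y (h ⟨y, hyB⟩ : B) := by
    have h1 := hr g' x y hxy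
    rw [hg'₁ x ha.symm, hg'₂ y (by rw [hB.gate_of_mem hG hyB]; exact hxB.symm),
      hg ⟨y, hyB⟩] at h1
    exact r.trans (r.symm hxy) h1
  have hrB : ∀ w z : B, r w z := by
    refine ((hprim B hB).eq_or_forall (r.comap Subtype.val) fun k w z hwz => ?_).resolve_left
      fun htriv => hhy (htriv _ _ (show r y (h ⟨y, hyB⟩ : B) from hyy)).symm
    obtain ⟨k', hk'⟩ := hext B B hB hB k
    change r (k w : B) (k z : B)
    rw [← hk', ← hk']
    exact hr k' _ _ hwz
  have hrC : ∀ w z, Γ.toSimpleGraphInclusive.Adj w z → r w z := by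
    intro w z hwz
    obtain ⟨C, hC, hw, hz⟩ := SimpleGraph.exists_isBlockSet_of_adj hwz
    obtain ⟨θ⟩ := hiso B C hB hC
    obtain ⟨k, hk⟩ := hext B C hB hC θ
    have h1 := hr k _ _ (hrB (θ.symm ⟨w, hw⟩) (θ.symm ⟨z, hz⟩))
    rwa [hk, hk, RelIso.apply_symm_apply, RelIso.apply_symm_apply] at h1
  refine huv (((SimpleGraph.preconnected_iff_forall_prop _).1 hG.preconnected (fun w => r u w)
    (fun w z hwz => ?_) u v).1 (r.refl u))
  exact ⟨fun h => r.trans h (hrC w z hwz), fun h => r.trans h (r.symm (hrC w z hwz))⟩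

end Digraph

/-! ### The characterization of primitivity -/

theorem mainTheorem1 {V : Type*} (Γ : Digraph V) (hloopless : ∀ α : V, ¬ Γ.Adj α α)
    (htrans : Γ.IsVertexTransitive) (hconn : Γ.HasConnectivityOne) :
    Γ.IsPrimitive ↔
      (∀ Λ : Γ.Subgraph, Λ.IsBlock →
        Λ.toDigraph.IsPrimitive ∧ ¬ Λ.toDigraph.IsAutRegular ∧ 3 ≤ Λ.verts.encard) ∧
      (∀ Λ₁ Λ₂ : Γ.Subgraph, Λ₁.IsBlock → Λ₂.IsBlock →
        Nonempty (Λ₁.toDigraph.Adj ≃r Λ₂.toDigraph.Adj)) := by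
  constructor
  · intro hprim
    refine ⟨fun Λ hΛ => ?_, fun Λ₁ Λ₂ hΛ₁ hΛ₂ => ?_⟩
    · have hB := hΛ.isBlockSet
      have hBprim := hprim.isPrimitive_induce hconn htrans hB
      rw [hΛ.toDigraph_eq]
      exact ⟨hBprim, hprim.not_isAutRegular hconn htrans hB hBprim,
        hprim.three_le_encard hconn htrans hB⟩
    · rw [hΛ₁.toDigraph_eq, hΛ₂.toDigraph_eq]
      obtain ⟨g, hg⟩ := hprim.exists_image_eq hconn hΛ₁.isBlockSet hΛ₂.isBlockSet
      exact ⟨g.induceIso hg⟩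
  · rintro ⟨hblocks, hiso⟩
    refine Digraph.isPrimitive_of_blocks hloopless hconn htrans (fun B C hB hC => ?_)
      (fun B hB => ?_) (fun B hB => ?_)
    · have := hiso _ _ (Digraph.Subgraph.isBlock_full hB) (Digraph.Subgraph.isBlock_full hC)
      rwa [Digraph.Subgraph.toDigraph_full, Digraph.Subgraph.toDigraph_full] at this
    · have := (hblocks _ (Digraph.Subgraph.isBlock_full hB)).1
      rwa [Digraph.Subgraph.toDigraph_full] at this
    · have := (hblocks _ (Digraph.Subgraph.isBlock_full hB)).2.1
      rwa [Digraph.Subgraph.toDigraph_full] at this
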